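/- Setting. Let $K$ users with $N_k$ receive antennas ($k=1,\dots,K$), a transmitter with $N_T$ antennas and an $N_I$-element reconfigurable intelligent surface (RIS) be given, and let $Z_0>0$. Put $D=\min\{\sum_{k=1}^K N_k,\,N_T\}$ and $L=\min\{D,\,N_I/2\}$. A channel realization consists of $H_{d,k}\in\mathbb C^{N_k\times N_T}$, $H_{r,k}\in\mathbb C^{N_k\times N_I}$ ($1\le k\le K$) and $G\in\mathbb C^{N_I\times N_T}$. For a real symmetric $B\in\mathbb R^{N_I\times N_I}$ let $\Theta=(I+\mathsf iZ_0B)^{-1}(I-\mathsf iZ_0B)$, and let $H_{\rm eff}(\Theta)$ be the vertical stacking of $H_{d,k}+H_{r,k}\Theta G$, $k=1,\dots,K$. A RIS architecture is a simple graph $\mathcal G$ on the ports $\{1,\dots,N_I\}$; it allows exactly the real symmetric $B$ with $B_{n,m}=0$ whenever $n\ne m$ and $\{n,m\}$ is not an edge of $\mathcal G$. The fully-connected RIS allows all real symmetric $B$. Given numbers of streams $d_1,\dots,d_K$, a utility $F(W,H)\in[-\infty,+\infty]$ and a constraint set $\mathcal W\subseteq\mathbb C^{N_T\times\sum_k d_k}$,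 let $P_{\mathcal G}$ be the supremum of $F(W,H_{\rm eff}(\Theta))$ over $W\in\mathcal W$ and the matrices $B$ allowed by $\mathcal G$, and let $P_{\rm fully}$ be the supremum over $W\in\mathcal W$ and all real symmetric $B$. The pair $(F,\mathcal W)$ is called regular if $H\mapsto\sup_{W\in\mathcal W}F(W,H)$ is lower semicontinuous; this is the case, for instance, for every $\mathcal W$ if each $F(W,\cdot)$ is continuous. A $q$-center graph is a graph with a set $\mathcal V_c$ of $q$ central vertices in which two distinct vertices are adjacent if and only if at least one of them lies in $\mathcal V_c$. The stem-connected RIS with stem width $q$ is the architecture of the $q$-center graph with $\mathcal V_c=\{1,\dots,q\}$, i.e. $B_{n,m}=0$ for all $n\ne m$ with $n,m>q$. Corollary. Let $q=2L-1$ be a nonnegative integer. (i) The adjacency matrix $A$ of the stem-connected RIS with stem width $q$ can be written as $A=P\bar AP^{T}$ with the reversal permutation matrix $P=[e_{N_I},e_{N_I-1},\dots,e_1]$ and a matrix $\bar A$ satisfying $\sum_{m=n+1}^{N_I}\bar A(n,m)=\min\{2L-1,\,N_I-n\}$ for $1\le n\le N_I-1$. (ii) The stem-connected RIS with stem width $q$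 almost surely achieves the same optimal performance as the fully-connected RIS: for Lebesgue-almost every channel realization, $P_{\mathcal G}=P_{\rm fully}$ for all regular pairs $(F,\mathcal W)$. (iii) The same holds for every $q$-center graph, whatever its set of $q$ central vertices. -/

import Mathlib

open MeasureTheory

namespace BDRIS

/-- The degree of freedom `D = min {∑ₖ Nₖ, N_T}` of the multiuser MIMO channel. -/
def dof {K : ℕ} (N : Fin K → ℕ) (NT : ℕ) : ℕ :=
  min (∑ k, N k) NT

/-- `L = min {D, N_I / 2}`, a real number (a half-integer when `L = N_I / 2` with `N_I` odd). -/
noncomputable def halfWidth {K : ℕ} (N : Fin K → ℕ) (NT NI : ℕ) : ℝ :=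
  min (dof N NT : ℝ) ((NI : ℝ) / 2)

/-! ### Architectures as graphs on the ports -/

/-- The graph with set `C` of central vertices: every central vertex is joined to all other
vertices, and the remaining vertices are joined to central vertices only. It is a
`q`-center graph when `C` has `q` elements. -/
def centerGraph {NI : ℕ} (C : Finset (Fin NI)) : SimpleGraph (Fin NI) where
  Adj n m := n ≠ m ∧ (n ∈ C ∨ m ∈ C)
  symm := ⟨fun _ _ h => ⟨h.1.symm, h.2.symm⟩⟩
  loopless := ⟨fun _ h => h.1 rfl⟩

instance {NI : ℕ} (C : Finset (Fin NI)) : DecidableRel (centerGraph C).Adj :=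
  fun n m => inferInstanceAs (Decidable (n ≠ m ∧ (n ∈ C ∨ m ∈ C)))

/-- The first `q` of the `N_I` ports. -/
def stemCenters (NI q : ℕ) : Finset (Fin NI) :=
  Finset.univ.filter fun n => (n : ℕ) < q

/-- The graph of the stem-connected RIS with stem width `q`: the center graph whose central
vertices are the first `q` ones. -/
abbrev stemGraph (NI q : ℕ) : SimpleGraph (Fin NI) :=
  centerGraph (stemCenters NI q)

/-- The set `𝓑_𝓖` of real matrices whose off-diagonal entries vanish outside the edges. -/
def susceptances {NI : ℕ} (G : SimpleGraph (Fin NI)) : Set (Matrix (Fin NI) (Fin NI) ℝ) :=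
  {B | ∀ n m, n ≠ m → ¬ G.Adj n m → B n m = 0}

/-- The row condition on a matrix `Abar`: for `1 ≤ n ≤ N_I - 1`,
`∑_{m = n+1}^{N_I} Abar(n, m) = min {2L - 1, N_I - n}`.
The indices of `Fin NI` start at `0`, so the one-based index is `(n : ℕ) + 1` here. -/
def RowCondition {NI : ℕ} (L : ℝ) (Abar : Matrix (Fin NI) (Fin NI) ℝ) : Prop :=
  ∀ n : Fin NI, (n : ℕ) + 1 ≤ NI - 1 →
    ∑ m ∈ Finset.Ioi n, Abar n m = min (2 * L - 1) ((NI : ℝ) - ((n : ℕ) + 1))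

/-- The condition on the graph, witnessed by the permutation matrix of `σ`:
`A_𝓖 = P Abar Pᵀ` where `Abar` satisfies the row condition. -/
def OptimalityCondition {NI : ℕ} (L : ℝ) (G : SimpleGraph (Fin NI)) [DecidableRel G.Adj]
    (σ : Equiv.Perm (Fin NI)) : Prop :=
  ∃ Abar : Matrix (Fin NI) (Fin NI) ℝ,
    G.adjMatrix ℝ = σ.permMatrix ℝ * Abar * (σ.permMatrix ℝ).transpose ∧ RowCondition L Abar

/-! ### The system model -/

/-- Channel realizations: the direct channels `H_{d,k}`, the channels `H_{r,k}` from the RIS to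
the users, and the channel `G` from the transmitter to the RIS. As a finite product of
copies of `ℂ` this carries Lebesgue measure. -/
abbrev Channels {K : ℕ} (N : Fin K → ℕ) (NT NI : ℕ) : Type :=
  (∀ k : Fin K, Fin (N k) → Fin NT → ℂ) × (∀ k : Fin K, Fin (N k) → Fin NI → ℂ) ×
    (Fin NI → Fin NT → ℂ)

/-- The scattering matrix `Θ = (I + i Z₀ B)⁻¹ (I - i Z₀ B)`. The inverse is a genuine one for
every real symmetric `B` and real `Z₀`. -/
noncomputable def scattering {NI : ℕ} (Z0 : ℝ) (B : Matrix (Fin NI) (Fin NI) ℝ) :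
    Matrix (Fin NI) (Fin NI) ℂ :=
  (1 + (Complex.I * (Z0 : ℂ)) • B.map Complex.ofReal)⁻¹ *
    (1 - (Complex.I * (Z0 : ℂ)) • B.map Complex.ofReal)

/-- The effective channel `H_{eff,k}(Θ) = H_{d,k} + H_{r,k} Θ G` of user `k`. -/
noncomputable def userChannel {K : ℕ} {N : Fin K → ℕ} {NT NI : ℕ} (c : Channels N NT NI)
    (Θ : Matrix (Fin NI) (Fin NI) ℂ) (k : Fin K) : Matrix (Fin (N k)) (Fin NT) ℂ :=
  Matrix.of (c.1 k) + Matrix.of (c.2.1 k) * Θ * Matrix.of c.2.2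

/-- The effective channels of all users, stacked; row `⟨k, i⟩` is row `i` of user `k`. -/
noncomputable def effectiveChannel {K : ℕ} {N : Fin K → ℕ} {NT NI : ℕ} (c : Channels N NT NI)
    (Θ : Matrix (Fin NI) (Fin NI) ℂ) : Matrix (Σ k : Fin K, Fin (N k)) (Fin NT) ℂ :=
  Matrix.of fun r t => userChannel c Θ r.1 r.2 t

/-- Utility functions `F(W, H)` of the stacked beamforming matrix `W = [W₁, …, W_K]` and the
stacked effective channel `H`. Values in the extended reals allow constraints to be encoded
in `F` by the value `-∞`. -/
abbrev Utility {K : ℕ} (N d : Fin K → ℕ) (NT : ℕ) : Type :=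
  Matrix (Fin NT) (Σ k : Fin K, Fin (d k)) ℂ → Matrix (Σ k : Fin K, Fin (N k)) (Fin NT) ℂ → EReal

/-- The optimal value of the joint design problem
maximize `F(W, H_eff(Θ))` over `(W, Θ, B)` subject to `Θ = (I + i Z₀ B)⁻¹ (I - i Z₀ B)`,
`B = Bᵀ`, `B ∈ 𝓑`, `W ∈ 𝓦`. -/
noncomputable def optimalValue {K : ℕ} {N d : Fin K → ℕ} {NT NI : ℕ} (Z0 : ℝ)
    (𝓑 : Set (Matrix (Fin NI) (Fin NI) ℝ)) (F : Utility N d NT)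
    (𝓦 : Set (Matrix (Fin NT) (Σ k : Fin K, Fin (d k)) ℂ)) (c : Channels N NT NI) : EReal :=
  sSup {v | ∃ (W : Matrix (Fin NT) (Σ k : Fin K, Fin (d k)) ℂ)
      (Θ : Matrix (Fin NI) (Fin NI) ℂ) (B : Matrix (Fin NI) (Fin NI) ℝ),
      Θ = scattering Z0 B ∧ B.IsSymm ∧ B ∈ 𝓑 ∧ W ∈ 𝓦 ∧ v = F W (effectiveChannel c Θ)}

/-- `P_𝓖`, the optimal performance of the architecture induced by the graph `G`. -/
noncomputable def graphValue {K : ℕ} {N d : Fin K → ℕ} {NT NI : ℕ} (Z0 : ℝ)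
    (G : SimpleGraph (Fin NI)) (F : Utility N d NT)
    (𝓦 : Set (Matrix (Fin NT) (Σ k : Fin K, Fin (d k)) ℂ)) (c : Channels N NT NI) : EReal :=
  optimalValue Z0 (susceptances G) F 𝓦 c

/-- `P_fully`, the optimal performance of the fully-connected RIS: no constraint on the
support of `B`. -/
noncomputable def fullValue {K : ℕ} {N d : Fin K → ℕ} {NT NI : ℕ} (Z0 : ℝ)
    (F : Utility N d NT)
    (𝓦 : Set (Matrix (Fin NT) (Σ k : Fin K, Fin (d k)) ℂ)) (c : Channels N NT NI) : EReal :=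
  optimalValue Z0 Set.univ F 𝓦 c

/-- The standing regularity of the utility: the best utility `sup_{W ∈ 𝓦} F(W, H)` for a given
effective channel `H` is lower semicontinuous in `H`. It holds for every `𝓦` when each `F(W, ·)`
is continuous, and also for power minimization under rate constraints. -/
def RegularUtility {K : ℕ} {N d : Fin K → ℕ} {NT : ℕ} (F : Utility N d NT)
    (𝓦 : Set (Matrix (Fin NT) (Σ k : Fin K, Fin (d k)) ℂ)) : Prop :=
  LowerSemicontinuous fun H : Matrix (Σ k : Fin K, Fin (N k)) (Fin NT) ℂ => ⨆ W ∈ 𝓦, F W H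

/-- The architecture induced by `G` achieves the same optimal performance as the fully-connected
RIS almost surely: for Lebesgue-almost every channel realization, `P_𝓖 = P_fully` for all
utilities and transmit constraint sets (the exceptional null set does not depend on them). -/
def AchievesFullPerformance {K : ℕ} (N d : Fin K → ℕ) (NT : ℕ) {NI : ℕ} (Z0 : ℝ)
    (G : SimpleGraph (Fin NI)) : Prop :=
  ∀ᵐ c : Channels N NT NI, ∀ (F : Utility N d NT)
    (𝓦 : Set (Matrix (Fin NT) (Σ k : Fin K, Fin (d k)) ℂ)),
    RegularUtility F 𝓦 → graphValue Z0 G F 𝓦 c = fullValue Z0 F 𝓦 c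

end BDRIS

/-! Since `Θ = 2(I + iZ₀B)⁻¹ - I`, the product `ΘG` depends on `B` only through `X = (I + iZ₀B)⁻¹G`,
and any symmetric `B'` with `B'X = BX` yields the same product (`scattering_mul_eq`). The rows of
`X` lie in a real space of dimension `2 N_T`. If `|C| = 2 N_T - 1`, the rows at `C` and two further
ports `n`, `m` satisfy a real relation `w`; generically `w n` and `w m` are nonzero. Subtracting a
multiple of `w wᵀ` from `B` keeps `BX` and symmetry and clears the entry `(n, m)`, touching no other
off-diagonal pair outside `C`. Clearing all such pairs moves `B` into the center graph
(`exists_mem_susceptances_centerGraph`).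

The exceptional null set of channels depends on `B`, so genericity is imposed for a countable dense
set of `B`; lower semicontinuity then gives equality of the suprema (`graphValue_eq_fullValue`). As
`Θ` is symmetric, the same argument applies to the transposed channels from the RIS to the users,
with `∑ Nₖ` in place of `N_T`. If `L = N_I / 2`, the center graph is complete. -/

namespace BDRIS

/-! ### Linear algebra of center graphs -/

/-- If the vectors indexed by `C` and one further index are always independent, while `C` and two
further indices are too many vectors, then there is a linear relation supported on `C`, `n`, `m`
whose coefficients at `n` and `m` do not vanish. -/
theorem exists_relation {ι E : Type*} [DecidableEq ι] [AddCommGroup E] [Module ℝ E]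
    [FiniteDimensional ℝ E] (X : ι → E) (C : Finset ι)
    (hcard : Module.finrank ℝ E < C.card + 2)
    (h : ∀ i ∉ C, LinearIndepOn ℝ X (insert i C : Finset ι))
    {n m : ι} (hnm : n ≠ m) (hn : n ∉ C) (hm : m ∉ C) :
    ∃ w : ι → ℝ, ∑ j ∈ insert n (insert m C), w j • X j = 0 ∧
      (∀ j ∉ insert n (insert m C), w j = 0) ∧ w n ≠ 0 ∧ w m ≠ 0 := by
  have hn' : n ∉ insert m C := by simp [hnm, hn]
  have hm' : m ∉ insert n C := by simp [hnm.symm, hm]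
  have hdep : ¬ LinearIndepOn ℝ X (insert n (insert m C) : Finset ι) := by
    intro hl
    have := LinearIndependent.fintype_card_le_finrank hl
    simp only [Fintype.card_coe, Finset.coe_sort_coe, Finset.card_insert_of_notMem hn',
      Finset.card_insert_of_notMem hm] at this
    omega
  rw [linearIndepOn_finset_iff] at hdep
  push Not at hdep
  obtain ⟨w, hw, i, hi, hwi⟩ := hdep
  refine ⟨fun j => if j ∈ insert n (insert m C) then w j else 0, ?_, ?_, ?_, ?_⟩
  · rw [← hw]
    exact Finset.sum_congr rfl fun j hj => by simp only [if_pos hj]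
  · intro j hj
    simp only [if_neg hj]
  · simp only [Finset.mem_insert_self, if_true]
    -- If `w n = 0`, the relation lives on `C ∪ {m}`, whose vectors are independent.
    intro h0
    rw [Finset.sum_insert hn', h0, zero_smul, zero_add] at hw
    rcases Finset.mem_insert.1 hi with rfl | hi
    · exact hwi h0
    · exact hwi (linearIndepOn_finset_iff.1 (h m hm) w hw i hi)
  · simp only [Finset.mem_insert, true_or, or_true, if_true]
    intro h0
    rw [Finset.insert_comm] at hw hi
    rw [Finset.sum_insert hm', h0, zero_smul, zero_add] at hw
    rcases Finset.mem_insert.1 hi with rfl | hi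
    · exact hwi h0
    · exact hwi (linearIndepOn_finset_iff.1 (h n hn) w hw i hi)

/-- A real symmetric matrix can be replaced by one supported on a center graph without changing
its action on sufficiently generic vectors. -/
theorem exists_mem_susceptances_centerGraph {NI : ℕ} {E : Type*} [AddCommGroup E] [Module ℝ E]
    [FiniteDimensional ℝ E] (X : Fin NI → E) (C : Finset (Fin NI))
    (hcard : Module.finrank ℝ E < C.card + 2)
    (h : ∀ i ∉ C, LinearIndepOn ℝ X (insert i C : Finset (Fin NI)))
    (B : Matrix (Fin NI) (Fin NI) ℝ) (hB : B.IsSymm) :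
    ∃ B' ∈ susceptances (centerGraph C), B'.IsSymm ∧
      ∀ i, ∑ j, B' i j • X j = ∑ j, B i j • X j := by
  -- One correction per pair `p`: it annihilates `X`, and above the diagonal outside `C` it is
  -- supported at `p` alone, so the corrections do not interfere.
  have key : ∀ p : Fin NI × Fin NI, ∃ Δ : Matrix (Fin NI) (Fin NI) ℝ, Δ.IsSymm ∧
      (∀ i, ∑ j, Δ i j • X j = 0) ∧ (p.1 < p.2 → p.1 ∉ C → p.2 ∉ C →
      Δ p.1 p.2 = B p.1 p.2 ∧ ∀ i ∉ C, ∀ j ∉ C, i < j → (i, j) ≠ p → Δ i j = 0) ∧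
      (¬ (p.1 < p.2 ∧ p.1 ∉ C ∧ p.2 ∉ C) → Δ = 0) := by
    rintro ⟨n, m⟩
    by_cases hp : n < m ∧ n ∉ C ∧ m ∉ C
    · obtain ⟨hlt, hn, hm⟩ := hp
      obtain ⟨w, hw, hw0, hwn, hwm⟩ := exists_relation X C hcard h hlt.ne hn hm
      have hw' : ∑ j, w j • X j = 0 := by
        rw [← hw]
        symm
        exact Finset.sum_subset (Finset.subset_univ _) fun j _ hj => by rw [hw0 j hj, zero_smul]
      -- The multiple of `w wᵀ` whose `(n, m)` entry is `B n m`.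
      refine ⟨Matrix.of fun i j => B n m / (w n * w m) * (w i * w j), ?_, ?_, ?_, ?_⟩
      · ext i j
        simp only [Matrix.transpose_apply, Matrix.of_apply]
        ring
      · intro i
        have : ∀ j, (Matrix.of fun i j => B n m / (w n * w m) * (w i * w j)) i j • X j =
            (B n m / (w n * w m) * w i) • (w j • X j) := by
          intro j
          rw [smul_smul, Matrix.of_apply, mul_assoc]
        simp only [this, ← Finset.smul_sum, hw', smul_zero]
      · intro _ _ _
        refine ⟨by simp only [Matrix.of_apply]; field_simp, ?_⟩
        intro i hi j hj hij hne
        have hz : w i = 0 ∨ w j = 0 := by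
          by_contra! hcon
          have h1 := mt (hw0 i) hcon.1
          have h2 := mt (hw0 j) hcon.2
          simp only [Finset.mem_insert, not_not, hi, hj, or_false] at h1 h2
          rcases h1 with rfl | rfl <;> rcases h2 with rfl | rfl
          · exact lt_irrefl _ hij
          · exact hne rfl
          · exact lt_asymm hij hlt
          · exact lt_irrefl _ hij
        rcases hz with hz | hz <;> simp [hz]
      · exact fun hcon => absurd ⟨hlt, hn, hm⟩ hcon
    -- The zero default lets the corrections be summed over all pairs.
    · exact ⟨0, by simp [Matrix.IsSymm], by simp, fun h1 h2 h3 => absurd ⟨h1, h2, h3⟩ hp,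
        fun _ => rfl⟩
  choose Δ hsymm hker hval hzero using key
  have hΔ : (∑ p, Δ p).IsSymm := by
    rw [Matrix.IsSymm, Matrix.transpose_sum]
    exact Finset.sum_congr rfl fun p _ => hsymm p
  have hS : (B - ∑ p, Δ p).IsSymm := hB.sub hΔ
  have hlt : ∀ i ∉ C, ∀ j ∉ C, i < j → (B - ∑ p, Δ p) i j = 0 := by
    intro i hi j hj hij
    rw [Matrix.sub_apply, Matrix.sum_apply, Finset.sum_eq_single (i, j), (hval (i, j) hij hi hj).1,
      sub_self]
    · intro p _ hp
      by_cases hc : p.1 < p.2 ∧ p.1 ∉ C ∧ p.2 ∉ C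
      · exact (hval p hc.1 hc.2.1 hc.2.2).2 i hi j hj hij hp.symm
      · rw [hzero p hc, Matrix.zero_apply]
    · simp
  refine ⟨B - ∑ p, Δ p, ?_, hS, ?_⟩
  · intro n m hnm hadj
    have hn : n ∉ C := fun hn => hadj ⟨hnm, Or.inl hn⟩
    have hm : m ∉ C := fun hm => hadj ⟨hnm, Or.inr hm⟩
    rcases lt_or_gt_of_ne hnm with hl | hl
    · exact hlt n hn m hm hl
    · rw [← hS.apply]
      exact hlt m hm n hn hl
  · intro i
    simp only [Matrix.sub_apply, Matrix.sum_apply, sub_smul, Finset.sum_sub_distrib,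
      Finset.sum_smul]
    rw [Finset.sum_comm]
    simp only [hker, Finset.sum_const_zero, sub_zero]

/-! ### Generic independence -/

/-- Almost all families of at most `dim E` vectors of `E` are linearly independent. -/
theorem ae_linearIndependent {E : Type*} [NormedAddCommGroup E] [NormedSpace ℝ E]
    [FiniteDimensional ℝ E] [MeasureSpace E] [BorelSpace E]
    [(volume : Measure E).IsAddHaarMeasure] (n : ℕ) (hn : n ≤ Module.finrank ℝ E) :
    ∀ᵐ v : Fin n → E, LinearIndependent ℝ v := by
  have : ProperSpace E := FiniteDimensional.proper_real E
  induction n with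
  | zero => exact Filter.Eventually.of_forall fun v => linearIndependent_empty_type
  | succ n ih =>
    let T : ((Fin n → E) × E) →ₗ[ℝ] (Fin (n + 1) → E) :=
      LinearMap.pi (Fin.cons (LinearMap.snd ℝ _ _)
        fun i => (LinearMap.proj i).comp (LinearMap.fst ℝ _ _))
    have hT : ∀ p, T p = (Fin.cons p.2 p.1 : Fin (n + 1) → E) := by
      intro p
      ext i
      refine Fin.cases ?_ (fun i => ?_) i <;> simp [T]
    have hsurj : Function.Surjective T := fun v =>
      ⟨(Fin.tail v, v 0), by rw [hT]; exact Fin.cons_self_tail v⟩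
    have hopen : IsOpen {v : Fin (n + 1) → E | LinearIndependent ℝ v} :=
      isOpen_setOfPred_linearIndependent
    have hTc : Continuous T := T.continuous_of_finiteDimensional
    have : (volume : Measure ((Fin n → E) × E)).IsAddHaarMeasure :=
      Measure.prod.instIsAddHaarMeasure _ _
    have hgoal := ae_comp_linearMap_mem_iff T (volume : Measure ((Fin n → E) × E))
      (volume : Measure (Fin (n + 1) → E)) hsurj hopen.measurableSet
    refine hgoal.1 ?_
    rw [Measure.volume_eq_prod]
    refine (Measure.ae_prod_iff_ae_ae (hopen.preimage hTc).measurableSet).2 ?_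
    filter_upwards [ih (by omega)] with v hv
    -- Fewer than `dim E` vectors span a proper subspace, which is null; almost every further vector
    -- avoids it.
    have hne : Submodule.span ℝ (Set.range v) ≠ ⊤ := by
      intro htop
      have := finrank_span_eq_card hv
      rw [htop, finrank_top, Fintype.card_fin] at this
      omega
    have h0 := Measure.addHaar_submodule (volume : Measure E) _ hne
    filter_upwards [measure_eq_zero_iff_ae_notMem.1 h0] with x hx
    show LinearIndependent ℝ (T (v, x))
    rw [hT, linearIndependent_finCons]
    exact ⟨hv, hx⟩

theorem ae_linearIndepOn {V ι E : Type*} [Fintype ι] [NormedAddCommGroup E] [NormedSpace ℝ E]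
    [FiniteDimensional ℝ E] [MeasureSpace E] [BorelSpace E]
    [(volume : Measure E).IsAddHaarMeasure]
    [NormedAddCommGroup V] [NormedSpace ℝ V] [FiniteDimensional ℝ V] [MeasureSpace V]
    [BorelSpace V] [(volume : Measure V).IsAddHaarMeasure]
    (T : V →ₗ[ℝ] (ι → E)) (hT : Function.Surjective T) (S : Finset ι)
    (hS : S.card ≤ Module.finrank ℝ E) :
    ∀ᵐ c : V, LinearIndepOn ℝ (T c) S := by
  let R : (ι → E) →ₗ[ℝ] (Fin S.card → E) := LinearMap.funLeft ℝ E (fun i => (S.equivFin.symm i : ι))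
  have hR : Function.Surjective R :=
    LinearMap.funLeft_surjective_of_injective ℝ E _
      (Subtype.val_injective.comp S.equivFin.symm.injective)
  have hopen : IsOpen {v : Fin S.card → E | LinearIndependent ℝ v} :=
    isOpen_setOfPred_linearIndependent
  have h := (ae_comp_linearMap_mem_iff (R.comp T) (volume : Measure V)
    (volume : Measure (Fin S.card → E)) (hR.comp hT) hopen.measurableSet).2
    (ae_linearIndependent S.card hS)
  filter_upwards [h] with c hc
  exact (linearIndependent_equiv S.equivFin.symm (f := fun i : S => T c i)).1 hc

/-! ### The scattering matrix -/

/-- The matrix `I + i Z₀ B`. -/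
noncomputable def impedance {NI : ℕ} (Z0 : ℝ) (B : Matrix (Fin NI) (Fin NI) ℝ) :
    Matrix (Fin NI) (Fin NI) ℂ :=
  1 + (Complex.I * (Z0 : ℂ)) • B.map Complex.ofReal

theorem isUnit_det_impedance {NI : ℕ} (Z0 : ℝ) {B : Matrix (Fin NI) (Fin NI) ℝ} (hB : B.IsSymm) :
    IsUnit (impedance Z0 B).det := by
  have hpd : (1 + (Z0 • B).conjTranspose * (Z0 • B)).PosDef :=
    Matrix.PosDef.one.add_posSemidef (Matrix.posSemidef_conjTranspose_mul_self _)
  -- `(I + iZ₀B)(I - iZ₀B) = I + (Z₀B)ᵀ(Z₀B)` is positive definite, so the first factor is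
  -- invertible.
  have hsq : impedance Z0 B * (1 - (Complex.I * (Z0 : ℂ)) • B.map Complex.ofReal) =
      (1 + (Z0 • B).conjTranspose * (Z0 • B)).map Complex.ofRealHom := by
    rw [Matrix.map_add _ (map_add _), Matrix.map_mul, Matrix.map_one _ (map_zero _) (map_one _),
      Matrix.conjTranspose_eq_transpose_of_trivial, Matrix.transpose_smul, hB.eq]
    have hs : (Z0 • B).map Complex.ofRealHom = (Z0 : ℂ) • B.map Complex.ofReal := by
      ext i j
      simp
    rw [hs, impedance, mul_sub, mul_one, add_mul, one_mul, smul_mul_smul_comm, smul_mul_smul_comm,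
      mul_mul_mul_comm, Complex.I_mul_I, add_sub_add_comm, sub_eq_add_neg, sub_eq_add_neg]
    simp
  have hdet : IsUnit ((1 + (Z0 • B).conjTranspose * (Z0 • B)).map Complex.ofRealHom).det := by
    rw [← RingHom.mapMatrix_apply, ← RingHom.map_det]
    exact (isUnit_iff_ne_zero.2 hpd.det_pos.ne').map _
  rw [← hsq, Matrix.det_mul] at hdet
  exact isUnit_of_mul_isUnit_left hdet

theorem scattering_eq {NI : ℕ} (Z0 : ℝ) {B : Matrix (Fin NI) (Fin NI) ℝ} (hB : B.IsSymm) :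
    scattering Z0 B = (2 : ℂ) • (impedance Z0 B)⁻¹ - 1 := by
  have h : (1 : Matrix (Fin NI) (Fin NI) ℂ) - (Complex.I * (Z0 : ℂ)) • B.map Complex.ofReal =
      (2 : ℂ) • 1 - impedance Z0 B := by
    rw [impedance, two_smul]
    abel
  rw [scattering, h]
  change (impedance Z0 B)⁻¹ * _ = _
  rw [mul_sub, Matrix.nonsing_inv_mul _ (isUnit_det_impedance Z0 hB), mul_smul_comm, mul_one]

theorem scattering_transpose {NI : ℕ} (Z0 : ℝ) {B : Matrix (Fin NI) (Fin NI) ℝ} (hB : B.IsSymm) :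
    (scattering Z0 B).transpose = scattering Z0 B := by
  have h : (impedance Z0 B).transpose = impedance Z0 B := by
    rw [impedance, Matrix.transpose_add, Matrix.transpose_one, Matrix.transpose_smul,
      ← Matrix.transpose_map, hB.eq]
  rw [scattering_eq Z0 hB, Matrix.transpose_sub, Matrix.transpose_smul,
    Matrix.transpose_nonsing_inv, h, Matrix.transpose_one]

/-- With `X = (I + iZ₀B)⁻¹G`, the hypothesis `B'X = BX` gives `(I + iZ₀B')X = G`, so `X` is also `(I
+ iZ₀B')⁻¹G`. -/
theorem scattering_mul_eq {NI : ℕ} {κ : Type*} (Z0 : ℝ) {B B' : Matrix (Fin NI) (Fin NI) ℝ}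
    (hB : B.IsSymm) (hB' : B'.IsSymm) (G : Matrix (Fin NI) κ ℂ)
    (h : ∀ i, ∑ j, B' i j • ((impedance Z0 B)⁻¹ * G) j = ∑ j, B i j • ((impedance Z0 B)⁻¹ * G) j) :
    scattering Z0 B' * G = scattering Z0 B * G := by
  have hmul : B'.map Complex.ofReal * ((impedance Z0 B)⁻¹ * G) =
      B.map Complex.ofReal * ((impedance Z0 B)⁻¹ * G) := by
    ext i k
    have := congrFun (h i) k
    simp only [Finset.sum_apply, Pi.smul_apply, Complex.real_smul] at this
    rw [Matrix.mul_apply, Matrix.mul_apply]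
    exact this
  have himp : impedance Z0 B' * ((impedance Z0 B)⁻¹ * G) = G := by
    rw [impedance, Matrix.add_mul, Matrix.smul_mul, hmul, ← Matrix.smul_mul, ← Matrix.add_mul,
      ← impedance, Matrix.mul_nonsing_inv_cancel_left _ _ (isUnit_det_impedance Z0 hB)]
  have hinv : (impedance Z0 B')⁻¹ * G = (impedance Z0 B)⁻¹ * G := by
    conv_lhs => rw [← himp]
    rw [Matrix.nonsing_inv_mul_cancel_left _ _ (isUnit_det_impedance Z0 hB')]
  rw [scattering_eq Z0 hB, scattering_eq Z0 hB', Matrix.sub_mul, Matrix.sub_mul, Matrix.smul_mul,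
    Matrix.smul_mul, hinv]

theorem continuous_scattering {NI : ℕ} (Z0 : ℝ) :
    Continuous fun B : {B : Matrix (Fin NI) (Fin NI) ℝ // B.IsSymm} =>
      scattering Z0 (B : Matrix (Fin NI) (Fin NI) ℝ) := by
  have hmap : Continuous fun B : {B : Matrix (Fin NI) (Fin NI) ℝ // B.IsSymm} =>
      (B : Matrix (Fin NI) (Fin NI) ℝ).map Complex.ofReal :=
    continuous_subtype_val.matrix_map Complex.continuous_ofReal
  have himp : Continuous fun B : {B : Matrix (Fin NI) (Fin NI) ℝ // B.IsSymm} =>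
      impedance Z0 (B : Matrix (Fin NI) (Fin NI) ℝ) :=
    continuous_const.add (hmap.const_smul (Complex.I * (Z0 : ℂ)))
  have hinv : Continuous fun B : {B : Matrix (Fin NI) (Fin NI) ℝ // B.IsSymm} =>
      (impedance Z0 (B : Matrix (Fin NI) (Fin NI) ℝ))⁻¹ := by
    simp only [Matrix.inv_def, Ring.inverse_eq_inv']
    exact (himp.matrix_det.inv₀ fun B => (isUnit_det_impedance Z0 B.2).ne_zero).smul
      himp.matrix_adjugate
  exact hinv.matrix_mul (continuous_const.sub (hmap.const_smul (Complex.I * (Z0 : ℂ))))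

theorem continuous_effectiveChannel {K : ℕ} {N : Fin K → ℕ} {NT NI : ℕ} (c : Channels N NT NI) :
    Continuous (effectiveChannel c) := by
  refine continuous_matrix fun r t => ?_
  have : Continuous fun Θ : Matrix (Fin NI) (Fin NI) ℂ => userChannel c Θ r.1 :=
    continuous_const.add ((continuous_const.matrix_mul continuous_id).matrix_mul continuous_const)
  exact this.matrix_elem r.2 t

/-! ### From dense agreement to equal optimal values -/

theorem graphValue_eq_fullValue {K : ℕ} {N d : Fin K → ℕ} {NT NI : ℕ} (Z0 : ℝ)
    (G : SimpleGraph (Fin NI)) (F : Utility N d NT)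
    (𝓦 : Set (Matrix (Fin NT) (Σ k : Fin K, Fin (d k)) ℂ)) (hF : RegularUtility F 𝓦)
    (c : Channels N NT NI) (S : Set {B : Matrix (Fin NI) (Fin NI) ℝ // B.IsSymm}) (hS : Dense S)
    (h : ∀ B ∈ S, ∃ B' ∈ susceptances G, B'.IsSymm ∧
      effectiveChannel c (scattering Z0 B') =
        effectiveChannel c (scattering Z0 (B : Matrix (Fin NI) (Fin NI) ℝ))) :
    graphValue Z0 G F 𝓦 c = fullValue Z0 F 𝓦 c := by
  apply le_antisymm
  · refine sSup_le_sSup ?_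
    rintro v ⟨W, Θ, B, hΘ, hB, -, hW, hv⟩
    exact ⟨W, Θ, B, hΘ, hB, Set.mem_univ _, hW, hv⟩
  · refine sSup_le ?_
    rintro v ⟨W, Θ, B, rfl, hB, -, hW, rfl⟩
    refine le_of_forall_lt fun a ha => ?_
    have ha' : a < ⨆ W ∈ 𝓦, F W (effectiveChannel c (scattering Z0 B)) :=
      ha.trans_le (le_iSup₂_of_le W hW le_rfl)
    have hcont := (continuous_effectiveChannel c).comp (continuous_scattering (NI := NI) Z0)
    -- Values above `a` persist for all `B₁` near `B`, and some such `B₁` lies in `S`.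
    have hev := (hcont.tendsto ⟨B, hB⟩).eventually (hF _ a ha')
    obtain ⟨B₁, hB₁, hB₁S⟩ := hS.exists_mem_open isOpen_interior
      ⟨_, mem_interior_iff_mem_nhds.2 hev⟩
    have hlt := interior_subset hB₁S
    obtain ⟨B', hB'G, hB', heq⟩ := h B₁ hB₁
    simp only [Set.mem_ofPred_eq, Function.comp_apply, ← heq] at hlt
    refine hlt.trans_le (iSup₂_le fun W' hW' => le_sSup ?_)
    exact ⟨W', _, B', rfl, hB', hB'G, hW', rfl⟩

/-! ### Generic channels -/

/-- If `c ↦ A c` depends surjectively and linearly on `c`, then for almost every `c` the products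
`Θ A` for a dense set of scattering matrices `Θ` are realized by the center graph. -/
theorem ae_exists_dense_scattering_mul_eq {NI : ℕ} {κ V : Type*} [Fintype κ]
    [NormedAddCommGroup V] [NormedSpace ℝ V] [FiniteDimensional ℝ V] [MeasureSpace V]
    [BorelSpace V] [(volume : Measure V).IsAddHaarMeasure] (Z0 : ℝ)
    (A : V →ₗ[ℝ] Matrix (Fin NI) κ ℂ) (hA : Function.Surjective A)
    (C : Finset (Fin NI)) (hC : C.card + 1 = 2 * Fintype.card κ) :
    ∀ᵐ c : V, ∃ S : Set {B : Matrix (Fin NI) (Fin NI) ℝ // B.IsSymm}, Dense S ∧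
      ∀ B ∈ S, ∃ B' ∈ susceptances (centerGraph C), B'.IsSymm ∧
        scattering Z0 B' * A c = scattering Z0 (B : Matrix (Fin NI) (Fin NI) ℝ) * A c := by
  have hfin : Module.finrank ℝ (κ → ℂ) = C.card + 1 := by
    rw [Module.finrank_pi_fintype, hC]
    simp [Complex.finrank_real_complex, mul_comm]
  have : SecondCountableTopology (Matrix (Fin NI) (Fin NI) ℝ) :=
    inferInstanceAs (SecondCountableTopology (Fin NI → Fin NI → ℝ))
  have : SecondCountableTopology {B : Matrix (Fin NI) (Fin NI) ℝ // B.IsSymm} :=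
    Topology.IsInducing.subtypeVal.secondCountableTopology
  obtain ⟨S, hScount, hSdense⟩ :=
    TopologicalSpace.exists_countable_dense {B : Matrix (Fin NI) (Fin NI) ℝ // B.IsSymm}
  -- For fixed `B`, the rows of `(I + iZ₀B)⁻¹A` depend surjectively on the channel, so they are
  -- generic; countability of `S` then allows one null set for all `B ∈ S`.
  have hgen : ∀ B ∈ S, ∀ᵐ c : V, ∀ i ∉ C, LinearIndepOn ℝ
      (fun j => ((impedance Z0 (B : Matrix (Fin NI) (Fin NI) ℝ))⁻¹ * A c) j)
      (insert i C : Finset (Fin NI)) := by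
    intro B _
    let T : V →ₗ[ℝ] (Fin NI → κ → ℂ) :=
      { toFun := fun c j => ((impedance Z0 (B : Matrix (Fin NI) (Fin NI) ℝ))⁻¹ * A c) j
        map_add' := fun x y => by
          rw [map_add, Matrix.mul_add]
          rfl
        map_smul' := fun r x => by
          rw [map_smul, Matrix.mul_smul]
          rfl }
    have hT : Function.Surjective T := by
      intro X
      obtain ⟨c, hc⟩ := hA (impedance Z0 (B : Matrix (Fin NI) (Fin NI) ℝ) * Matrix.of X)
      refine ⟨c, ?_⟩
      change (impedance Z0 (B : Matrix (Fin NI) (Fin NI) ℝ))⁻¹ * A c = Matrix.of X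
      rw [hc, Matrix.nonsing_inv_mul_cancel_left _ _ (isUnit_det_impedance Z0 B.2)]
    rw [ae_all_iff]
    intro i
    by_cases hi : i ∈ C
    · exact Filter.Eventually.of_forall fun _ h => absurd hi h
    · filter_upwards [ae_linearIndepOn T hT (insert i C)
        (by rw [hfin, Finset.card_insert_of_notMem hi])] with c hc _
      exact hc
  filter_upwards [(ae_ball_iff hScount).2 hgen] with c hc
  refine ⟨S, hSdense, fun B hB => ?_⟩
  obtain ⟨B', hB'G, hB', heq⟩ := exists_mem_susceptances_centerGraph _ C
    (by rw [hfin]; omega) (hc B hB) B B.2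
  exact ⟨B', hB'G, hB', scattering_mul_eq Z0 B.2 hB' _ heq⟩

theorem isAddHaarMeasure_channels {K : ℕ} (N : Fin K → ℕ) (NT NI : ℕ) :
    (volume : Measure (Channels N NT NI)).IsAddHaarMeasure := by
  have hmat : ∀ a b : ℕ, (volume : Measure (Fin a → Fin b → ℂ)).IsAddHaarMeasure := fun _ _ =>
    Measure.pi.isAddHaarMeasure _
  have husers : ∀ b : ℕ, (volume : Measure (∀ k : Fin K, Fin (N k) → Fin b → ℂ)).IsAddHaarMeasure :=
    fun b =>
      have : ∀ k, (volume : Measure (Fin (N k) → Fin b → ℂ)).IsAddHaarMeasure := fun k => hmat _ _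
      Measure.pi.isAddHaarMeasure _
  have hris : (volume : Measure ((∀ k : Fin K, Fin (N k) → Fin NI → ℂ) ×
      (Fin NI → Fin NT → ℂ))).IsAddHaarMeasure :=
    Measure.prod.instIsAddHaarMeasure _ _
  have : MeasurableAdd ((∀ k : Fin K, Fin (N k) → Fin NI → ℂ) × (Fin NI → Fin NT → ℂ)) :=
    ContinuousAdd.measurableAdd
  exact Measure.prod.instIsAddHaarMeasure _ _

theorem achievesFullPerformance_of_transmit {K : ℕ} (N d : Fin K → ℕ) (NT : ℕ) {NI : ℕ} (Z0 : ℝ)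
    (C : Finset (Fin NI)) (hC : C.card + 1 = 2 * NT) :
    AchievesFullPerformance N d NT Z0 (centerGraph C) := by
  have := isAddHaarMeasure_channels N NT NI
  let A : Channels N NT NI →ₗ[ℝ] Matrix (Fin NI) (Fin NT) ℂ :=
    { toFun := fun c => Matrix.of c.2.2
      map_add' := fun _ _ => rfl
      map_smul' := fun _ _ => rfl }
  filter_upwards [ae_exists_dense_scattering_mul_eq Z0 A (fun X => ⟨(0, 0, X), rfl⟩) C
    (by rw [Fintype.card_fin, hC])] with c hc F 𝓦 hF
  obtain ⟨S, hS, h⟩ := hc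
  refine graphValue_eq_fullValue Z0 _ F 𝓦 hF c S hS fun B hB => ?_
  obtain ⟨B', hB'G, hB', heq⟩ := h B hB
  refine ⟨B', hB'G, hB', ?_⟩
  have heq' : scattering Z0 B' * Matrix.of c.2.2 = scattering Z0 B.1 * Matrix.of c.2.2 := heq
  ext r t
  simp only [effectiveChannel, userChannel, Matrix.mul_assoc, heq']

theorem achievesFullPerformance_of_receive {K : ℕ} (N d : Fin K → ℕ) (NT : ℕ) {NI : ℕ} (Z0 : ℝ)
    (C : Finset (Fin NI)) (hC : C.card + 1 = 2 * ∑ k, N k) :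
    AchievesFullPerformance N d NT Z0 (centerGraph C) := by
  have := isAddHaarMeasure_channels N NT NI
  let A : Channels N NT NI →ₗ[ℝ] Matrix (Fin NI) (Σ k : Fin K, Fin (N k)) ℂ :=
    { toFun := fun c => Matrix.of fun n r => c.2.1 r.1 r.2 n
      map_add' := fun _ _ => rfl
      map_smul' := fun _ _ => rfl }
  filter_upwards [ae_exists_dense_scattering_mul_eq Z0 A
    (fun X => ⟨(0, fun k i n => X n ⟨k, i⟩, 0), rfl⟩) C (by simp [hC])] with c hc F 𝓦 hF
  obtain ⟨S, hS, h⟩ := hc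
  refine graphValue_eq_fullValue Z0 _ F 𝓦 hF c S hS fun B hB => ?_
  obtain ⟨B', hB'G, hB', heq⟩ := h B hB
  refine ⟨B', hB'G, hB', ?_⟩
  -- Symmetry of `Θ` turns `ΘH_rᵀ` into `H_rΘ`.
  have hT := congrArg Matrix.transpose heq
  rw [Matrix.transpose_mul, Matrix.transpose_mul, scattering_transpose Z0 hB',
    scattering_transpose Z0 B.2] at hT
  have hk : ∀ k, Matrix.of (c.2.1 k) * scattering Z0 B' =
      Matrix.of (c.2.1 k) * scattering Z0 B.1 := by
    intro k
    ext i n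
    exact congrFun (congrFun hT ⟨k, i⟩) n
  ext r t
  simp only [effectiveChannel, userChannel, hk]

theorem achievesFullPerformance_of_complete {K : ℕ} (N d : Fin K → ℕ) (NT : ℕ) {NI : ℕ} (Z0 : ℝ)
    (C : Finset (Fin NI)) (hC : C.card + 1 = NI) :
    AchievesFullPerformance N d NT Z0 (centerGraph C) := by
  have huniv : susceptances (centerGraph C) = Set.univ := by
    refine Set.eq_univ_of_forall fun B n m hnm hadj => ?_
    have hn : n ∉ C := fun hn => hadj ⟨hnm, Or.inl hn⟩
    -- A missing edge would need two ports outside `C`, but only one exists.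
    have hm : m ∉ C := fun hm => hadj ⟨hnm, Or.inr hm⟩
    have hcard := Finset.card_le_univ (insert n (insert m C))
    rw [Finset.card_insert_of_notMem (by simp [hnm, hn]), Finset.card_insert_of_notMem hm,
      Fintype.card_fin] at hcard
    omega
  refine Filter.Eventually.of_forall fun c F 𝓦 _ => ?_
  rw [graphValue, huniv, fullValue]

theorem achievesFullPerformance_centerGraph {K : ℕ} (N d : Fin K → ℕ) (NT : ℕ) {NI : ℕ} (Z0 : ℝ)
    (C : Finset (Fin NI)) (hC : (C.card : ℝ) = 2 * halfWidth N NT NI - 1) :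
    AchievesFullPerformance N d NT Z0 (centerGraph C) := by
  rw [halfWidth] at hC
  rcases le_total ((NI : ℝ) / 2) (dof N NT : ℝ) with h | h
  · rw [min_eq_right h] at hC
    refine achievesFullPerformance_of_complete N d NT Z0 C ?_
    have : ((C.card + 1 : ℕ) : ℝ) = NI := by push_cast; linarith
    exact_mod_cast this
  · rw [min_eq_left h] at hC
    have hdof : C.card + 1 = 2 * dof N NT := by
      have : ((C.card + 1 : ℕ) : ℝ) = ((2 * dof N NT : ℕ) : ℝ) := by push_cast; linarith
      exact_mod_cast this
    rcases le_total (∑ k, N k) NT with h' | h'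
    · rw [dof, min_eq_left h'] at hdof
      exact achievesFullPerformance_of_receive N d NT Z0 C hdof
    · rw [dof, min_eq_right h'] at hdof
      exact achievesFullPerformance_of_transmit N d NT Z0 C hdof

/-! ### The stem graph -/

theorem card_stemCenters {NI q : ℕ} (hq : q ≤ NI) : (stemCenters NI q).card = q := by
  rw [stemCenters, Fin.card_filter_val_lt, min_eq_right hq]

/-- Reversal puts the centers last, so the part of a row right of the diagonal becomes the ports
before `n.rev`; its neighbours among them are those below `q`. -/
theorem optimalityCondition_stemGraph {NI q : ℕ} {L : ℝ} (hq : (q : ℝ) = 2 * L - 1) :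
    OptimalityCondition L (stemGraph NI q) Fin.revPerm := by
  refine ⟨((stemGraph NI q).adjMatrix ℝ).submatrix Fin.rev Fin.rev, ?_, ?_⟩
  · rw [Matrix.transpose_permMatrix, Equiv.Perm.permMatrix, Equiv.Perm.permMatrix,
      PEquiv.toMatrix_toPEquiv_mul, PEquiv.mul_toMatrix_toPEquiv]
    ext i j
    have hrev : (Equiv.symm Fin.revPerm⁻¹) j = j.rev := rfl
    simp [hrev]
  · intro n hn
    have hsum : ∑ m ∈ Finset.Ioi n, ((stemGraph NI q).adjMatrix ℝ).submatrix Fin.rev Fin.rev n m =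
        ∑ p ∈ Finset.Iio n.rev, (stemGraph NI q).adjMatrix ℝ n.rev p := by
      refine Finset.sum_nbij' Fin.rev Fin.rev ?_ ?_ ?_ ?_ ?_ <;> simp [Fin.lt_rev_iff]
    have hadj : ∀ p ∈ Finset.Iio n.rev, (stemGraph NI q).adjMatrix ℝ n.rev p =
        if (p : ℕ) < q then 1 else 0 := by
      intro p hp
      have hp' : p < n.rev := Finset.mem_Iio.1 hp
      have hiff : (stemGraph NI q).Adj n.rev p ↔ (p : ℕ) < q := by
        simp only [stemGraph, centerGraph, stemCenters, Finset.mem_filter, Finset.mem_univ,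
          true_and]
        refine ⟨fun h => ?_, fun h => ⟨hp'.ne', Or.inr h⟩⟩
        -- If `n.rev` itself is central, every smaller port is central too.
        rcases h.2 with h | h
        · exact lt_trans hp' h
        · exact h
      simp only [SimpleGraph.adjMatrix_apply, hiff]
    have hcard : ((Finset.Iio n.rev).filter fun p : Fin NI => (p : ℕ) < q).card =
        min q (NI - (n + 1)) := by
      have : ((Finset.Iio n.rev).filter fun p : Fin NI => (p : ℕ) < q) =
          Finset.univ.filter fun p : Fin NI => (p : ℕ) < min q (NI - (n + 1)) := by
        ext p
        simp [Fin.lt_def, Fin.val_rev, and_comm]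
      rw [this, Fin.card_filter_val_lt]
      omega
    rw [hsum, Finset.sum_congr rfl hadj, Finset.sum_boole, hcard, ← hq, Nat.cast_min,
      Nat.cast_sub n.2]
    push_cast
    rfl

end BDRIS

theorem corollary2 {K : ℕ} (N d : Fin K → ℕ) (NT NI : ℕ) (Z0 : ℝ) (hZ0 : 0 < Z0)
    (q : ℕ) (hq : (q : ℝ) = 2 * BDRIS.halfWidth N NT NI - 1) :
    BDRIS.OptimalityCondition (BDRIS.halfWidth N NT NI) (BDRIS.stemGraph NI q) Fin.revPerm ∧
    BDRIS.AchievesFullPerformance N d NT Z0 (BDRIS.stemGraph NI q) ∧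
    ∀ C : Finset (Fin NI), C.card = q →
      BDRIS.AchievesFullPerformance N d NT Z0 (BDRIS.centerGraph C) := by
  have hcenter : ∀ C : Finset (Fin NI), C.card = q →
      BDRIS.AchievesFullPerformance N d NT Z0 (BDRIS.centerGraph C) := fun C hC =>
    BDRIS.achievesFullPerformance_centerGraph N d NT Z0 C (by rw [hC, hq])
  refine ⟨BDRIS.optimalityCondition_stemGraph hq, hcenter _ (BDRIS.card_stemCenters ?_), hcenter⟩
  have hle : BDRIS.halfWidth N NT NI ≤ (NI : ℝ) / 2 := min_le_right _ _
  have : (q : ℝ) ≤ NI := by linarith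
  exact_mod_cast this
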